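/- Let $K'$ be a number field, let $X$ be a variety over $K'$ (an integral separated scheme of finite type over $K'$), and let $f\colon X\dashrightarrow X$ be a dominant rational self-map defined over $K'$. Let $U\subset X$ be a nonempty affine open subset on which $f$ is regular, with coordinate ring $\mathcal O(U)=K'[x_1,\dots,x_m]$ generated by functions $x_1,\dots,x_m$ such that $x_1,\dots,x_n$ are algebraically independent over $K'$ and $x_{n+1},\dots,x_m$ are integral over $K'[x_1,\dots,x_n]$; let $P_i$ be the minimal monic polynomial of $x_{n+i}$ over $K'[x_1,\dots,x_n]$. Let $\mathcal U=\operatorname{Spec}\mathcal O_{K'}[x_1,\dots,x_m]$ be the corresponding integral model of $U$, on which $f$ is also regarded as a rational self-map. Let $\mathfrak p'$ be a nonzero prime of $\mathcal O_{K'}$ such that all $P_i$ have $\mathfrak p'$-integral coefficients, let $K$ be a finite extension of $K'$, let $\mathfrak p$ be a prime of $\mathcal O_K$ above $\mathfrak p'$, and let $K_{\mathfrak p}$ be the completion of $K$ at $\mathfrak p$. Let $y\in U(K_{\mathfrak p})$ be a point with $\mathfrak p$-integral coordinates $x_1(y),\dots,x_m(y)$, and let $x$ be its reduction, a point of $\bar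 U=\mathcal U\bmod\mathfrak p'$ with values in the residue field of $K_{\mathfrak p}$. Assume that the values of the derivatives $P_i'$ at $x$ are nonzero, that $f$ (as a rational self-map of $\mathcal U$) is defined at $x$ and at all its iterates under the reduction $\bar f$ of $f$, that $\bar f$ is unramified at all these points, and that $x$ is periodic: $\bar f^k(x)=x$ for some $k\geq 1$. Put $$O_{\mathfrak p,y}=\{t\in U(K_{\mathfrak p})\mid x_i(t)\equiv x_i(y)\pmod{\mathfrak p}\ \text{ for } 1\leq i\leq m\}.$$ Then there exists a positive integer $N$ such that every point of $O_{\mathfrak p,y}$ which is preperiodic for $f$ is periodic for $f$, of period at most $N$. (Here a point $t$ is preperiodic if $f^i(t)=f^j(t)$ for some $0\leq i<j$, the iterates up to $f^j(t)$ being defined, and periodic of period at most $N$ if $f^q(t)=t$ for some $1\leq q\leq N$, the iterates up to $f^q(t)$ being defined.) -/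

import Mathlib

open AlgebraicGeometry CategoryTheory NumberField IsDedekindDomain

universe u

noncomputable section

namespace PadicDynamics

/-! ### Iteration of a rational self-map on points -/

section Orbits

variable {X : Scheme.{u}}

/-- The rational self-map `f` is defined at the `T`-valued point `a` of `X`, with value `b`:
some representative of `f` has a domain through which `a` factors, and it sends `a` to `b`. -/
def MapsTo (f : X.RationalMap X) {T : Scheme.{u}} (a b : T ⟶ X) : Prop :=
  ∃ g : X.PartialMap X, g.toRationalMap = f ∧
    ∃ a' : T ⟶ g.domain.toScheme, a' ≫ g.domain.ι = a ∧ a' ≫ g.hom = b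

/-- `f ^ i` is defined along the orbit of `a`, and `f ^ i (a) = b`. -/
def IterMapsTo (f : X.RationalMap X) {T : Scheme.{u}} : ℕ → (T ⟶ X) → (T ⟶ X) → Prop
  | 0, a, b => a = b
  | i + 1, a, b => ∃ c, IterMapsTo f i a c ∧ MapsTo f c b

/-- The point `a` is preperiodic: `f ^ i (a) = f ^ j (a)` for some `i < j`. -/
def IsPreperiodic (f : X.RationalMap X) {T : Scheme.{u}} (a : T ⟶ X) : Prop :=
  ∃ i j : ℕ, i < j ∧ ∃ b, IterMapsTo f i a b ∧ IterMapsTo f j a b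

/-- The point `a` is periodic, of period at most `N`. -/
def IsPeriodicOfPeriodLE (f : X.RationalMap X) (N : ℕ) {T : Scheme.{u}} (a : T ⟶ X) : Prop :=
  ∃ q : ℕ, 0 < q ∧ q ≤ N ∧ IterMapsTo f q a a

end Orbits

/-! ### Rational maps of an affine integral model, seen near a point of a special fibre -/

section LocalRings

variable {A F κ : Type*} [CommRing A] [Field F] [Field κ]

/-- The local ring of `Spec A` at the (image of the) `κ`-valued point `x`. -/
abbrev LocalRingAt (x : A →+* κ) : Type _ :=
  haveI : (RingHom.ker x).IsPrime := RingHom.ker_isPrime x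
  Localization.AtPrime (RingHom.ker x)

/-- The value at `x` of a function that is regular at `x`. -/
def evalAt (x : A →+* κ) : LocalRingAt x →+* κ :=
  haveI : (RingHom.ker x).IsPrime := RingHom.ker_isPrime x
  IsLocalization.lift (M := (RingHom.ker x).primeCompl) (g := x)
    (fun s => IsUnit.mk0 _ (fun h => s.2 ((RingHom.mem_ker (f := x)).2 h)))

/-- The local ring at `x` inside a field `F` that contains `A`. -/
def toField {ι : A →+* F} (hι : Function.Injective ι) (x : A →+* κ) : LocalRingAt x →+* F :=
  haveI : (RingHom.ker x).IsPrime := RingHom.ker_isPrime x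
  IsLocalization.lift (M := (RingHom.ker x).primeCompl) (g := ι)
    (fun s => IsUnit.mk0 _ (fun h => s.2 ((RingHom.mem_ker (f := x)).2 (by
      rw [(injective_iff_map_eq_zero ι).1 hι _ h, map_zero]))))

/-- Let `A` be a domain with inclusion `ι` into its function field `F`, and let `g : A →+* F` be
the pull-back of functions under a rational self-map `f` of `Spec A`.  Let `P` be an ideal of `A`
and `x`, `x'` two `κ`-valued points (of the closed fibre `Spec (A / P)`).  This says:

* `f` is defined at `x`, that is, `g` takes values in the local ring of `Spec A` at `x`;
* `f (x) = x'`;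
* the reduction of `f` modulo `P` is unramified at `x`, that is, the local ring `𝒪 / P 𝒪` of the
  closed fibre at `x` is (formally) unramified over the closed fibre via `f`. -/
def UnramifiedStep {ι : A →+* F} (hι : Function.Injective ι) (g : A →+* F) (P : Ideal A)
    (x x' : A →+* κ) : Prop :=
  ∃ φ : A →+* LocalRingAt x,
    (∀ a, toField hι x (φ a) = g a) ∧
    (∀ a, evalAt x (φ a) = x' a) ∧
    ((Ideal.Quotient.mk (P.map (algebraMap A (LocalRingAt x)))).comp φ).FormallyUnramified

end LocalRings

/-! ### Affine charts with a Noether normalization, and their integral models -/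

section Charts

variable (k : Type u) [Field k] (X : Scheme.{u}) [X.Over (Spec (.of k))]

/-- The constants `k → Γ(X, U)` of a `k`-scheme `X`. -/
def constants (U : X.Opens) : k →+* Γ(X, U) :=
  ((Scheme.ΓSpecIso (.of k)).inv ≫ (X ↘ Spec (.of k)).appLE ⊤ U le_top).hom

/-- A nonempty affine open `U` of the `k`-scheme `X` with generators
`x_1, …, x_n, x_{n+1}, …, x_{n+r}` of its coordinate ring over `k`, the first `n` of which form a
Noether normalization: they are algebraically independent, and the others are integral over
`k[x_1, …, x_n]`. -/
structure Chart (n r : ℕ) where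
  U : X.Opens
  isAffineOpen : IsAffineOpen U
  nonempty : Nonempty U
  coord : Fin n ⊕ Fin r → Γ(X, U)
  generate : Function.Surjective (MvPolynomial.eval₂Hom (constants k X U) coord)
  independent : Function.Injective
    (MvPolynomial.eval₂Hom (constants k X U) (fun i => coord (Sum.inl i)))
  integral : ∀ i, (MvPolynomial.eval₂Hom (constants k X U)
    (fun i => coord (Sum.inl i))).IsIntegralElem (coord (Sum.inr i))

namespace Chart

variable {k X} {n r : ℕ} (C : Chart k X n r)

instance : Nonempty C.U := C.nonempty

/-- `k[X_1, …, X_n] → Γ(X, U)`, the pull-back under `π = (x_1, …, x_n) : U → 𝔸ⁿ`. -/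
def noether : MvPolynomial (Fin n) k →+* Γ(X, C.U) :=
  MvPolynomial.eval₂Hom (constants k X C.U) (fun i => C.coord (Sum.inl i))

/-- The minimal monic polynomial `P_i` of `x_{n+i}` over `k[x_1, …, x_n]`. -/
def minPoly (i : Fin r) : Polynomial (MvPolynomial (Fin n) k) :=
  letI := C.noether.toAlgebra
  minpoly (MvPolynomial (Fin n) k) (C.coord (Sum.inr i))

/-- The function `P_i' (x_{n+i})` on `U`. -/
def minPolyDeriv (i : Fin r) : Γ(X, C.U) :=
  (C.minPoly i).derivative.eval₂ C.noether (C.coord (Sum.inr i))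

/-- The point of `X` given by a homomorphism from the coordinate ring of `U`. -/
def toPoint {L : Type u} [Field L] (t : Γ(X, C.U) →+* L) : Spec (.of L) ⟶ X :=
  Spec.map (CommRingCat.ofHom t) ≫ C.isAffineOpen.fromSpec

/-- The ring `𝓞_k[x_1, …, x_{n+r}]`, the coordinate ring of the integral model of `U`. -/
def model : Subring Γ(X, C.U) :=
  (MvPolynomial.eval₂Hom ((constants k X C.U).comp (algebraMap (𝓞 k) k)) C.coord).range

/-- The structure map `𝓞_k → 𝓞_k[x_1, …, x_{n+r}]`. -/
def modelConstants : 𝓞 k →+* C.model :=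
  (MvPolynomial.eval₂Hom ((constants k X C.U).comp (algebraMap (𝓞 k) k))
    C.coord).rangeRestrict.comp MvPolynomial.C

/-- The inclusion of the coordinate ring of the model in the function field of `X`. -/
def modelToField [IsIntegral X] : C.model →+* X.functionField :=
  (X.germToFunctionField C.U).hom.comp C.model.subtype

lemma modelToField_injective [IsIntegral X] : Function.Injective C.modelToField :=
  (X.germToFunctionField_injective C.U).comp Subtype.val_injective

/-- `g : Γ(X, U) → k(X)` is the pull-back `f^*` of functions under the rational map `f` (there is
exactly one such `g` if `f` is dominant). -/
def IsPullback [IsIntegral X] (f : X.RationalMap X) (g : Γ(X, C.U) →+* X.functionField) : Prop :=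
  f.fromFunctionField =
    Spec.map (CommRingCat.ofHom g : Γ(X, C.U) ⟶ X.functionField) ≫ C.isAffineOpen.fromSpec

end Chart

end Charts

/-! ### The `𝔭`-adic neighbourhoods -/

section Neighbourhoods

variable {k : Type u} [Field k] {X : Scheme.{u}} [X.Over (Spec (.of k))] {n r : ℕ}
  {K : Type u} [Field K] [NumberField K] [Algebra k K]

/-- `t` is a `K_𝔭`-point of `U`: a `k`-algebra homomorphism `Γ(X, U) → K_𝔭`. -/
def IsPoint (C : Chart k X n r) (v : HeightOneSpectrum (𝓞 K))
    (t : Γ(X, C.U) →+* v.adicCompletion K) : Prop :=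
  t.comp (constants k X C.U) = (algebraMap K (v.adicCompletion K)).comp (algebraMap k K)

/-- The point `x` of the integral model is the reduction modulo `𝔭` of the point `y` of `U`. -/
def IsReduction (C : Chart k X n r) (v : HeightOneSpectrum (𝓞 K))
    (y : Γ(X, C.U) →+* v.adicCompletion K)
    (x : C.model →+* IsLocalRing.ResidueField (v.adicCompletionIntegers K)) : Prop :=
  ∀ a : C.model, ∃ h : y a ∈ v.adicCompletionIntegers K,
    x a = IsLocalRing.residue (v.adicCompletionIntegers K) ⟨y a, h⟩

/-- The neighbourhood `O_{𝔭,y} = {t ∈ U(K_𝔭) | x_i(t) ≡ x_i(y) mod 𝔭 for all i}`. -/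
def neighbourhood (C : Chart k X n r) (v : HeightOneSpectrum (𝓞 K))
    (y : Γ(X, C.U) →+* v.adicCompletion K) : Set (Γ(X, C.U) →+* v.adicCompletion K) :=
  {t | IsPoint C v t ∧ ∀ i, Valued.v (t (C.coord i) - y (C.coord i)) < 1}

/-- The choices from which `O_{𝔭,y}` is constructed: primes `𝔭` of `K` over `𝔭'` of `k`, and a
point `y ∈ U(K_𝔭)` with integral coordinates whose reduction `x` is periodic under the reduction
of `f`, no iterate of `x` being an indeterminacy or a ramification point. -/
structure NeighbourhoodData [NumberField k] [IsIntegral X] (f : X.RationalMap X)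
    (C : Chart k X n r) (v' : HeightOneSpectrum (𝓞 k)) (v : HeightOneSpectrum (𝓞 K))
    (y : Γ(X, C.U) →+* v.adicCompletion K) : Prop where
  /-- `f` is regular on `U`. -/
  regular : C.U ≤ f.domain
  /-- `𝔭` lies over `𝔭'`. -/
  liesOver : v.asIdeal.comap (algebraMap (𝓞 k) (𝓞 K)) = v'.asIdeal
  /-- The minimal polynomials `P_i` have `𝔭'`-integral coefficients. -/
  minPoly_integral : ∀ i j d, v'.valuation k (((C.minPoly i).coeff j).coeff d) ≤ 1
  isPoint : IsPoint C v y
  /-- The coordinates of `y` are `𝔭`-integral. -/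
  coord_integral : ∀ i, Valued.v (y (C.coord i)) ≤ 1
  /-- `P_i'` does not vanish modulo `𝔭` at the reduction of `y`. -/
  minPolyDeriv_unit : ∀ i, Valued.v (y (C.minPolyDeriv i)) = 1
  /-- The reduction `x 0` of `y` has an orbit `x 0, x 1, …, x m = x 0` under the reduction of `f`
  modulo `𝔭'`, along which `f` is defined and its reduction is unramified. -/
  periodic : ∃ g, C.IsPullback f g ∧
    ∃ (x : ℕ → C.model →+* IsLocalRing.ResidueField (v.adicCompletionIntegers K)) (m : ℕ),
      IsReduction C v y (x 0) ∧ 0 < m ∧ x m = x 0 ∧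
      ∀ i < m, UnramifiedStep C.modelToField_injective (g.comp C.model.subtype)
        (v'.asIdeal.map C.modelConstants) (x i) (x (i + 1))

end Neighbourhoods

end PadicDynamics

end

noncomputable section

namespace PadicDynamics

/-! ### Lifting points to local rings -/

section LocalPoints

variable {A κ B : Type*} [CommRing A] [Field κ] [CommRing B]

/-! Let `R` be the ring of integers of the completion, `ϖ` a uniformizer, and `m` a period of the
reduction `x`. Since `f` is defined along the orbit of `x`, `f^m` acts on the points of the integral
model that reduce to `x`, with values in any ring `B` with a local homomorphism to the residue
field, functorially in `B`. Unramifiedness along the orbit makes this return map injective when the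
kernel of `B → κ` has powers with zero intersection (`IsOrbit.injective`).

For finite `B` there are finitely many such points over fixed constants, so some power `M` of the
return map is the identity (`IsOrbit.exists_return_eq`). Take `B` to be the dual numbers over
`R/ϖ^J`: then `F = f^(mM)` is trivial modulo `ϖ^J` on points and on tangent vectors. Two `R`-points
congruent modulo `ϖ^l`, `l ≥ J`, form one point over the ring of congruent pairs, and the divided
difference sends it to a dual-number point; hence `F` preserves their difference modulo `ϖ^(l+J)`
(`IsOrbit.exists_near_translation`).

Choose `J` so that `ϖ^J` divides no prime number. If `F^p` fixes a point with `p` prime, adding up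
`p` nearly equal displacements gives `p • displacement ≈ 0`, which makes the displacement divisible
by every power of `ϖ`. So `F` has no cycle of length greater than one
(`NearTranslation.eq_of_periodic`). By injectivity preperiodic points are periodic, hence fixed by
`F`, and `N = mM` works. -/

instance (x : A →+* κ) : (RingHom.ker x).IsPrime := RingHom.ker_isPrime x

@[ext]
lemma LocalRingAt.ringHom_ext {x : A →+* κ} {h h' : LocalRingAt x →+* B}
    (H : h.comp (algebraMap A _) = h'.comp (algebraMap A _)) : h = h' :=
  IsLocalization.ringHom_ext (RingHom.ker x).primeCompl H

lemma evalAt_comp_algebraMap (x : A →+* κ) : (evalAt x).comp (algebraMap A _) = x :=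
  IsLocalization.lift_comp _

/-- Functions that do not vanish at `x` become units in `B`, because `ρ` reflects units. -/
lemma LocalRingAt.exists_lift {x : A →+* κ} (ρ : B →+* κ) [IsLocalHom ρ] {h : A →+* B}
    (hx : ρ.comp h = x) : ∃ l : LocalRingAt x →+* B, l.comp (algebraMap A _) = h := by
  have H (s : (RingHom.ker x).primeCompl) : IsUnit (h s) := by
    refine isUnit_of_map_unit ρ _ (IsUnit.mk0 _ fun h0 ↦ s.2 ?_)
    rw [← RingHom.comp_apply, hx] at h0
    exact h0
  exact ⟨IsLocalization.lift H, IsLocalization.lift_comp H⟩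

lemma LocalRingAt.comp_lift {x : A →+* κ} (ρ : B →+* κ) {h : A →+* B} (hx : ρ.comp h = x)
    {l : LocalRingAt x →+* B} (hl : l.comp (algebraMap A _) = h) : ρ.comp l = evalAt x := by
  ext1
  rw [RingHom.comp_assoc, hl, hx, evalAt_comp_algebraMap]

end LocalPoints

/-! ### Orbits of points with values in local rings -/

section Orbits

variable {Λ A κ ι : Type*} [CommRing Λ] [CommRing A] [Field κ] {x : ι → A →+* κ}

/-- `u 0, u 1, …` is a sequence of `B`-valued points, each of which is the image of the
preceding one under the rational map given by `φ (σ i) : A → 𝒪_{x (σ i)}`. -/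
def IsOrbit (σ : ℕ → ι) (φ : ∀ j, A →+* LocalRingAt (x j)) {B : Type*} [CommRing B]
    (u : ℕ → A →+* B) : Prop :=
  ∀ i, ∃ l : LocalRingAt (x (σ i)) →+* B, l.comp (algebraMap A _) = u i ∧ l.comp (φ _) = u (i + 1)

variable {σ : ℕ → ι} {φ : ∀ j, A →+* LocalRingAt (x j)} {B B' : Type*} [CommRing B] [CommRing B']

namespace IsOrbit

lemma map {u : ℕ → A →+* B} (hu : IsOrbit σ φ u) (θ : B →+* B') :
    IsOrbit σ φ (fun i ↦ θ.comp (u i)) := fun i ↦ by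
  obtain ⟨l, h1, h2⟩ := hu i
  exact ⟨θ.comp l, by rw [RingHom.comp_assoc, h1], by rw [RingHom.comp_assoc, h2]⟩

lemma shift {u : ℕ → A →+* B} (hu : IsOrbit σ φ u) {m : ℕ} (hσ : Function.Periodic σ m) (k : ℕ) :
    IsOrbit σ φ (fun i ↦ u (i + m * k)) := fun i ↦ by
  have key {j : ι} (hj : j = σ i) (h : ∃ l : LocalRingAt (x j) →+* B,
      l.comp (algebraMap A _) = u (i + m * k) ∧ l.comp (φ _) = u (i + m * k + 1)) :
      ∃ l : LocalRingAt (x (σ i)) →+* B,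
        l.comp (algebraMap A _) = u (i + m * k) ∧ l.comp (φ _) = u (i + 1 + m * k) := by
    subst hj
    rwa [add_right_comm]
  exact key (by simpa [mul_comm] using hσ.nat_mul k i) (hu (i + m * k))

/-- A homomorphism out of the local ring is determined on `A`, so each point determines the next. -/
lemma unique {u u' : ℕ → A →+* B} (hu : IsOrbit σ φ u) (hu' : IsOrbit σ φ u') (h0 : u 0 = u' 0) :
    u = u' := by
  funext i
  induction i with
  | zero => exact h0
  | succ i ih =>
    obtain ⟨l, h1, h2⟩ := hu i
    obtain ⟨l', h1', h2'⟩ := hu' i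
    obtain rfl : l = l' := by ext1; rw [h1, h1', ih]
    rw [← h2, h2']

lemma comp_eq {u : ℕ → A →+* B} (hu : IsOrbit σ φ u) (ρ : B →+* κ)
    (hφ : ∀ i, (evalAt _).comp (φ (σ i)) = x (σ (i + 1))) (h0 : ρ.comp (u 0) = x (σ 0)) (i : ℕ) :
    ρ.comp (u i) = x (σ i) := by
  induction i with
  | zero => exact h0
  | succ i ih =>
    obtain ⟨l, h1, h2⟩ := hu i
    rw [← h2, ← RingHom.comp_assoc, LocalRingAt.comp_lift ρ ih h1, hφ]

lemma comp_const {u : ℕ → A →+* B} (hu : IsOrbit σ φ u) {c : Λ →+* A}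
    (hc : ∀ j, (φ j).comp c = (algebraMap A _).comp c) (i : ℕ) :
    (u i).comp c = (u 0).comp c := by
  induction i with
  | zero => rfl
  | succ i ih =>
    obtain ⟨l, h1, h2⟩ := hu i
    rw [← ih, ← h2, ← h1, RingHom.comp_assoc, hc, RingHom.comp_assoc]

/-- The image of a point reducing to `x (σ i)` reduces to `x (σ (i + 1))`, so it lifts to the next
local ring and the construction never stops. -/
lemma exists_orbit (ρ : B →+* κ) [IsLocalHom ρ]
    (hφ : ∀ i, (evalAt _).comp (φ (σ i)) = x (σ (i + 1))) (h : A →+* B)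
    (h0 : ρ.comp h = x (σ 0)) : ∃ u : ℕ → A →+* B, u 0 = h ∧ IsOrbit σ φ u := by
  have step (i : ℕ) (h : {h : A →+* B // ρ.comp h = x (σ i)}) :
      ∃ h' : {h : A →+* B // ρ.comp h = x (σ (i + 1))}, ∃ l : LocalRingAt (x (σ i)) →+* B,
        l.comp (algebraMap A _) = h ∧ l.comp (φ _) = h' := by
    obtain ⟨l, hl⟩ := LocalRingAt.exists_lift ρ h.2
    exact ⟨⟨l.comp (φ _), by rw [← RingHom.comp_assoc, LocalRingAt.comp_lift ρ h.2 hl, hφ]⟩,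
      l, hl, rfl⟩
  choose F hF using step
  let u : ∀ i, {h : A →+* B // ρ.comp h = x (σ i)} := fun i ↦ Nat.rec ⟨h, h0⟩ F i
  exact ⟨fun i ↦ (u i).1, rfl, fun i ↦ hF i (u i)⟩

/-- Two preimages of one point extend to `A`-algebra maps `l`, `l'` out of the local ring, the
structure being given by `φ`. They agree modulo `ker ρ`, and formal unramifiedness with `hρ` forces
equality. Descend step by step to index 0. -/
lemma injective {u u' : ℕ → A →+* B} (hu : IsOrbit σ φ u) (hu' : IsOrbit σ φ u') (ρ : B →+* κ)
    (hρ : ⨅ i, RingHom.ker ρ ^ i = (⊥ : Ideal B))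
    (hφ : ∀ i, (evalAt _).comp (φ (σ i)) = x (σ (i + 1)))
    (hunr : ∀ j, (φ j).FormallyUnramified)
    (h0 : ρ.comp (u 0) = x (σ 0)) (h0' : ρ.comp (u' 0) = x (σ 0)) {n : ℕ} (hn : u n = u' n) :
    u 0 = u' 0 := by
  induction n with
  | zero => exact hn
  | succ n ih =>
    apply ih
    obtain ⟨l, h1, h2⟩ := hu n
    obtain ⟨l', h1', h2'⟩ := hu' n
    have e := LocalRingAt.comp_lift ρ (hu.comp_eq ρ hφ h0 n) h1
    have e' := LocalRingAt.comp_lift ρ (hu'.comp_eq ρ hφ h0' n) h1'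
    rw [← h1, ← h1']
    congr 1
    let _ := (φ (σ n)).toAlgebra
    let _ := (u (n + 1)).toAlgebra
    have : Algebra.FormallyUnramified A (LocalRingAt (x (σ n))) := hunr _
    let g : LocalRingAt (x (σ n)) →ₐ[A] B := { l with commutes' := fun a ↦ congr($h2 a) }
    let g' : LocalRingAt (x (σ n)) →ₐ[A] B :=
      { l' with commutes' := fun a ↦ congr($(h2'.trans hn.symm) a) }
    have := Algebra.FormallyUnramified.ext_of_iInf (RingHom.ker ρ) hρ (g₁ := g) (g₂ := g') (fun z ↦ by
        rw [Ideal.Quotient.eq, RingHom.mem_ker, map_sub, sub_eq_zero]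
        exact congr($(e.trans e'.symm) z))
    exact RingHom.ext fun z ↦ congr($this z)

/-- If the ring of values is finite, then some power of the return map is the identity. -/
lemma exists_return_eq [Finite B] (ρ : B →+* κ) [IsLocalHom ρ]
    {m : ℕ} (hσ : Function.Periodic σ m)
    (hφ : ∀ i, (evalAt _).comp (φ (σ i)) = x (σ (i + 1)))
    (hunr : ∀ j, (φ j).FormallyUnramified) {c : Λ →+* A}
    (hc : ∀ j, (φ j).comp c = (algebraMap A _).comp c) (cB : Λ →+* B)
    (hfin : Finite {h : A →+* B // h.comp c = cB}) :
    ∃ M, 0 < M ∧ ∀ u : ℕ → A →+* B, IsOrbit σ φ u → ρ.comp (u 0) = x (σ 0) →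
      (u 0).comp c = cB → u (m * M) = u 0 := by
  let Y := {h : A →+* B // ρ.comp h = x (σ 0) ∧ h.comp c = cB}
  have : Finite Y := Finite.of_injective (fun h : Y ↦ (⟨h.1, h.2.2⟩ : {h : A →+* B // h.comp c = cB}))
    fun a b h ↦ Subtype.ext congr($(h).1)
  have hex (h : Y) : ∃ u : ℕ → A →+* B, u 0 = h ∧ IsOrbit σ φ u :=
    exists_orbit ρ hφ h.1 h.2.1
  choose o ho0 ho using hex
  have hσm : σ m = σ 0 := by simpa using hσ 0
  let G : Y → Y := fun h ↦ ⟨o h m,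
    by rw [(ho h).comp_eq ρ hφ (by rw [ho0]; exact h.2.1), hσm],
    by rw [(ho h).comp_const hc, ho0]; exact h.2.2⟩
  -- As `ρ` is local, its kernel lies in the Jacobson radical, which is nilpotent in a finite ring.
  have hρ : ⨅ i, RingHom.ker ρ ^ i = (⊥ : Ideal B) := by
    obtain ⟨n, hn⟩ := IsArtinianRing.isNilpotent_jacobson_bot (R := B)
    have hle : RingHom.ker ρ ≤ Ideal.jacobson ⊥ := fun b hb ↦ by
      rw [Ideal.mem_jacobson_bot]
      intro y
      refine isUnit_of_map_unit ρ _ ?_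
      rw [map_add, map_mul, (RingHom.mem_ker).1 hb]
      simp
    refine eq_bot_iff.2 ((iInf_le _ n).trans ((Ideal.pow_right_mono hle n).trans hn.le))
  have hG : Function.Injective G := fun a b hab ↦ by
    have : o a m = o b m := congr($(hab).1)
    have := (ho a).injective (ho b) ρ hρ hφ hunr (by rw [ho0]; exact a.2.1)
      (by rw [ho0]; exact b.2.1) this
    rw [ho0, ho0] at this
    exact Subtype.ext this
  obtain ⟨M, hM0, hM⟩ := isOfFinOrder_iff_pow_eq_one.1
    (isOfFinOrder_of_finite (Equiv.ofBijective G (Finite.injective_iff_bijective.1 hG) : Equiv.Perm Y))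
  refine ⟨M, hM0, fun u hu h0 hc0 ↦ ?_⟩
  have key (k : ℕ) : u (m * k) = (G^[k] ⟨u 0, h0, hc0⟩).1 := by
    induction k with
    | zero => rfl
    | succ k ih =>
      rw [Function.iterate_succ_apply']
      have := (hu.shift hσ k).unique (ho (G^[k] ⟨u 0, h0, hc0⟩)) (by rw [ho0, ← ih, zero_add])
      have := congr($this m)
      rw [← show m + m * k = m * (k + 1) by ring]
      exact this
  rw [key]
  have h1 := congr($hM ⟨u 0, h0, hc0⟩)
  have h2 := Equiv.Perm.iterate_eq_pow
    (Equiv.ofBijective G (Finite.injective_iff_bijective.1 hG) : Equiv.Perm Y) M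
  have h3 := congr_fun h2 ⟨u 0, h0, hc0⟩
  rw [h1] at h3
  exact congr($(h3).1)

end IsOrbit

end Orbits

/-! ### Sequences that are close to translations -/

section Translations

variable {R Z : Type*} [CommRing R]

/-- The differences `w a - w b` which are divisible by a power `ϖ ^ l` with `l ≥ J` do not change
modulo `ϖ ^ (l + J)` under the shift of `w`. -/
def NearTranslation (ϖ : R) (J : ℕ) (w : ℕ → Z → R) : Prop :=
  ∀ a b l, J ≤ l → (∀ z, ϖ ^ l ∣ w a z - w b z) →
    ∀ z, ϖ ^ (l + J) ∣ (w (a + 1) z - w (b + 1) z) - (w a z - w b z)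

variable {ϖ : R} {J : ℕ} {w : ℕ → Z → R}

namespace NearTranslation

/-- The divisibility by `ϖ ^ l` survives each shift, so the one-step estimates can be added. -/
lemma dvd_shift (hw : NearTranslation ϖ J w) {a b l : ℕ} (hl : J ≤ l)
    (h : ∀ z, ϖ ^ l ∣ w a z - w b z) (e : ℕ) (z : Z) :
    ϖ ^ (l + J) ∣ (w (a + e) z - w (b + e) z) - (w a z - w b z) := by
  induction e generalizing z with
  | zero => simp
  | succ e ih =>
    have h' (z : Z) : ϖ ^ l ∣ w (a + e) z - w (b + e) z := by
      simpa using dvd_add ((pow_dvd_pow ϖ (Nat.le_add_right l J)).trans (ih z)) (h z)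
    convert dvd_add (hw (a + e) (b + e) l hl h' z) (ih z) using 1
    simp only [← add_assoc]
    ring

lemma subsequence (hw : NearTranslation ϖ J w) (k e : ℕ) :
    NearTranslation ϖ J (fun j ↦ w (k + e * j)) := fun a b l hl h z ↦ by
  simpa [mul_add, add_assoc] using hw.dvd_shift hl h e z

/-- Telescoping gives `w p - w 0 ≡ p (w 1 - w 0)` modulo `ϖ ^ (2J + l)` once `ϖ ^ (J + l)` divides
`w 1 - w 0`. The left side is zero and `ϖ ^ J ∤ p`, so the displacement gains a further factor `ϖ`;
iterate. -/
lemma eq_of_prime [IsDomain R] [IsDiscreteValuationRing R] (hϖ : Irreducible ϖ)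
    (hw : NearTranslation ϖ J w) (h0 : ∀ z, ϖ ^ J ∣ w 1 z - w 0 z) {p : ℕ}
    (hp : ¬ ϖ ^ J ∣ (p : R)) (hper : w p = w 0) : w 1 = w 0 := by
  have key (l : ℕ) : ∀ z, ϖ ^ (J + l) ∣ w 1 z - w 0 z := by
    induction l with
    | zero => exact h0
    | succ l ih =>
      intro z
      have hsum (k : ℕ) : ϖ ^ (J + l + J) ∣ w k z - w 0 z - k * (w 1 z - w 0 z) := by
        induction k with
        | zero => simp
        | succ k ihk =>
          have := hw.dvd_shift (Nat.le_add_right J l) ih k z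
          convert dvd_add ihk this using 1
          rw [Nat.cast_succ, zero_add, add_comm 1 k]
          ring
      obtain ⟨q, hq⟩ := ih z
      have h1 := hsum p
      rw [hper, sub_self, zero_sub, dvd_neg, hq, mul_left_comm, pow_add,
        mul_dvd_mul_iff_left (pow_ne_zero _ hϖ.ne_zero)] at h1
      rw [hq, ← add_assoc, pow_succ]
      refine mul_dvd_mul_left _ ?_
      by_contra hq'
      have hu : IsUnit q := by
        by_contra hu
        have := (IsLocalRing.mem_maximalIdeal q).2 hu
        rw [hϖ.maximalIdeal_eq, Ideal.mem_span_singleton] at this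
        exact hq' this
      exact hp ((hu.dvd_mul_right).1 h1)
  funext z
  rw [← sub_eq_zero]
  by_contra hne
  obtain ⟨n, u, hu⟩ := IsDiscreteValuationRing.eq_unit_mul_pow_irreducible hne hϖ
  have h1 := (pow_dvd_pow ϖ (Nat.le_add_left (n + 1) J)).trans (key (n + 1) z)
  rw [hu, Units.dvd_mul_left, pow_dvd_pow_iff hϖ.ne_zero hϖ.not_isUnit] at h1
  omega

lemma eq_of_periodic [IsDomain R] [IsDiscreteValuationRing R] (hϖ : Irreducible ϖ)
    (hw : NearTranslation ϖ J w) (h0 : ∀ a b z, ϖ ^ J ∣ w a z - w b z)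
    (hp : ∀ p : ℕ, p.Prime → ¬ ϖ ^ J ∣ (p : R)) {d : ℕ} (hd : d ≠ 0)
    (hper : Function.Periodic w d) (k : ℕ) : w (k + 1) = w k := by
  induction d using Nat.strong_induction_on with
  | _ d ih =>
    by_cases h1 : d = 1
    · subst h1
      exact hper k
    obtain ⟨e, he⟩ := Nat.minFac_dvd d
    have hpr := Nat.minFac_prime h1
    have he0 : e ≠ 0 := by rintro rfl; simp at he; exact hd he
    -- Write `d = p e` with `p` prime. Sampling `w` from `a` in steps of `e` gives a sequence that
    -- returns after `p` steps, so `e` is already a period.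
    refine ih e ?_ he0 fun a ↦ ?_
    · have := hpr.two_le
      calc e < 2 * e := by omega
        _ ≤ d.minFac * e := by gcongr
        _ = d := he.symm
    · have := (hw.subsequence a e).eq_of_prime hϖ (fun z ↦ h0 _ _ z) (hp _ hpr) (by
        simp only [mul_zero, add_zero]
        rw [mul_comm, ← he]
        exact hper a)
      simpa using this

end NearTranslation

/-- In a discrete valuation ring of characteristic zero, a high power of the maximal ideal contains
no prime number. -/
lemma exists_pow_not_dvd_prime [IsDomain R] [IsDiscreteValuationRing R] [CharZero R]
    (hϖ : Irreducible ϖ) : ∃ J, ∀ p : ℕ, p.Prime → ¬ ϖ ^ J ∣ (p : R) := by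
  by_cases h : ∃ p : ℕ, p.Prime ∧ ϖ ∣ (p : R)
  · obtain ⟨p, hp, hpd⟩ := h
    obtain ⟨n, u, hu⟩ := IsDiscreteValuationRing.eq_unit_mul_pow_irreducible
      (Nat.cast_ne_zero.2 hp.ne_zero : (p : R) ≠ 0) hϖ
    -- Here `n` is the valuation of `p`; any other prime is coprime to `p`, hence not divisible by
    -- `ϖ`.
    refine ⟨n + 1, fun q hq hqd ↦ ?_⟩
    by_cases hpq : q = p
    · rw [hpq, hu, Units.dvd_mul_left, pow_dvd_pow_iff hϖ.ne_zero hϖ.not_isUnit] at hqd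
      omega
    · have hq' : ϖ ∣ (q : R) := (dvd_pow_self ϖ n.succ_ne_zero).trans hqd
      have := (Nat.isCoprime_iff_coprime.2 ((Nat.coprime_primes hq hp).2 hpq)).map (Int.castRingHom R)
      simp only [eq_intCast, Int.cast_natCast] at this
      exact hϖ.not_isUnit (this.isUnit_of_dvd' hq' hpd)
  · exact ⟨1, fun p hp hd ↦ h ⟨p, hp, by simpa using hd⟩⟩

end Translations

/-! ### Pairs of congruent elements and dual numbers -/

section Pairs

variable {R : Type*} [CommRing R]

/-- The ring of pairs of elements of `R` which are congruent modulo `a`. -/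
def congruentPairs (a : R) : Subring (R × R) where
  carrier := {z | a ∣ z.1 - z.2}
  mul_mem' {z w} hz hw := by
    have : z.1 * w.1 - z.2 * w.2 = (z.1 - z.2) * w.1 + z.2 * (w.1 - w.2) := by ring
    simpa [this] using dvd_add (hz.mul_right w.1) (hw.mul_left z.2)
  one_mem' := by simp
  add_mem' {z w} hz hw := by simpa [add_sub_add_comm] using dvd_add hz hw
  zero_mem' := by simp
  neg_mem' {z} hz := by
    change a ∣ -z.1 - -z.2
    rw [show -z.1 - -z.2 = -(z.1 - z.2) by ring]
    exact hz.neg_right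

lemma mem_congruentPairs {a : R} {z : R × R} : z ∈ congruentPairs a ↔ a ∣ z.1 - z.2 := Iff.rfl

/-- The divided difference `(z, w) ↦ w + ((z - w) / a) ε`, modulo an ideal that contains `a`. -/
def dividedDifference [IsDomain R] {a : R} (ha : a ≠ 0) {I : Ideal R} (hI : a ∈ I) :
    congruentPairs a →+* DualNumber (R ⧸ I) where
  toFun z := TrivSqZeroExt.inl (Ideal.Quotient.mk I z.1.2) +
    TrivSqZeroExt.inr (Ideal.Quotient.mk I (mem_congruentPairs.1 z.2).choose)
  map_one' := by
    have h0 : (mem_congruentPairs.1 (1 : congruentPairs a).2).choose = 0 := by simp [ha]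
    rw [h0]; simp
  map_zero' := by
    have h0 : (mem_congruentPairs.1 (0 : congruentPairs a).2).choose = 0 := by simp [ha]
    rw [h0]; simp
  map_add' z w := by
    have h := (mem_congruentPairs.1 (z + w).2).choose_spec
    have hz := (mem_congruentPairs.1 z.2).choose_spec
    have hw := (mem_congruentPairs.1 w.2).choose_spec
    have : (mem_congruentPairs.1 (z + w).2).choose = (mem_congruentPairs.1 z.2).choose +
        (mem_congruentPairs.1 w.2).choose := by
      apply mul_left_cancel₀ ha
      rw [← h, mul_add, ← hz, ← hw]
      simp only [Subring.coe_add, Prod.fst_add, Prod.snd_add]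
      ring
    rw [this]
    ext <;> simp
  map_mul' z w := by
    have h := (mem_congruentPairs.1 (z * w).2).choose_spec
    have hz := (mem_congruentPairs.1 z.2).choose_spec
    have hw := (mem_congruentPairs.1 w.2).choose_spec
    -- The Leibniz rule holds up to a multiple of `a`, which vanishes modulo `I`.
    have : (mem_congruentPairs.1 (z * w).2).choose = (mem_congruentPairs.1 z.2).choose * w.1.2 +
        (mem_congruentPairs.1 w.2).choose * z.1.2 + a * ((mem_congruentPairs.1 z.2).choose *
        (mem_congruentPairs.1 w.2).choose) := by
      apply mul_left_cancel₀ ha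
      rw [← h]
      simp only [Subring.coe_mul, Prod.fst_mul, Prod.snd_mul]
      linear_combination w.1.1 * hz + z.1.2 * hw + a * (mem_congruentPairs.1 z.2).choose * hw
    rw [this]
    have h0 : Ideal.Quotient.mk I a = 0 := Ideal.Quotient.eq_zero_iff_mem.2 hI
    ext
    · simp
    · simp [h0]
      ring

lemma fst_dividedDifference [IsDomain R] {a : R} (ha : a ≠ 0) {I : Ideal R} (hI : a ∈ I)
    (z : congruentPairs a) :
    (dividedDifference ha hI z).fst = Ideal.Quotient.mk I z.1.2 := by
  simp [dividedDifference]

/-- Used for constants, on which two points agree: the dual-number point then has constants without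
`ε`-part. -/
lemma dividedDifference_of_eq [IsDomain R] {a : R} (ha : a ≠ 0) {I : Ideal R} (hI : a ∈ I)
    {z : congruentPairs a} (h : z.1.1 = z.1.2) :
    dividedDifference ha hI z = TrivSqZeroExt.inl (Ideal.Quotient.mk I z.1.2) := by
  have hz := (mem_congruentPairs.1 z.2).choose_spec
  have h0 : (mem_congruentPairs.1 z.2).choose = 0 :=
    (mul_eq_zero.1 (hz.symm.trans (sub_eq_zero.2 h))).resolve_left ha
  simp only [dividedDifference, RingHom.coe_mk, MonoidHom.coe_mk, OneHom.coe_mk]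
  rw [h0]
  simp

lemma dvd_of_dividedDifference_eq [IsDomain R] {a b : R} (ha : a ≠ 0)
    (hI : a ∈ Ideal.span {b}) {z w : congruentPairs a}
    (h : dividedDifference ha hI z = dividedDifference ha hI w) :
    a * b ∣ (z.1.1 - z.1.2) - (w.1.1 - w.1.2) := by
  have hz := (mem_congruentPairs.1 z.2).choose_spec
  have hw := (mem_congruentPairs.1 w.2).choose_spec
  have h1 := congr(TrivSqZeroExt.snd $h)
  simp only [dividedDifference, RingHom.coe_mk, MonoidHom.coe_mk, OneHom.coe_mk,
    TrivSqZeroExt.snd_add, TrivSqZeroExt.snd_inl, TrivSqZeroExt.snd_inr, zero_add,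
    Ideal.Quotient.eq, Ideal.mem_span_singleton] at h1
  rw [hz, hw, ← mul_sub]
  exact mul_dvd_mul_left a h1

end Pairs

/-! ### The return map over a discrete valuation ring -/

lemma finite_ringHom_of_finiteType {Λ A B : Type*} [CommRing Λ] [CommRing A] [CommRing B] [Finite B]
    {c : Λ →+* A} (hc : c.FiniteType) (cB : Λ →+* B) : Finite {h : A →+* B // h.comp c = cB} := by
  let _ := c.toAlgebra
  let _ := cB.toAlgebra
  obtain ⟨s, hs⟩ := hc.out
  refine Finite.of_injective
    (fun (h : {h : A →+* B // h.comp c = cB}) (z : s) ↦ h.1 z) fun h h' H ↦ Subtype.ext ?_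
  let g : A →ₐ[Λ] B := { h.1 with commutes' := fun a ↦ congr($(h.2) a) }
  let g' : A →ₐ[Λ] B := { h'.1 with commutes' := fun a ↦ congr($(h'.2) a) }
  have : g = g' := AlgHom.ext_of_adjoin_eq_top hs fun z hz ↦ congr_fun H ⟨z, hz⟩
  exact RingHom.ext fun z ↦ congr($this z)

/-! ### Residue maps of congruent pairs and of dual numbers are local -/

section LocalRings

variable {R κ : Type*} [CommRing R] [Field κ] (ρ : R →+* κ) [IsLocalHom ρ]

lemma isUnit_iff_map_ne_zero {a : R} : IsUnit a ↔ ρ a ≠ 0 :=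
  ⟨fun h ↦ (h.map ρ).ne_zero, fun h ↦ isUnit_of_map_unit ρ a (IsUnit.mk0 _ h)⟩

lemma map_eq_zero_of_irreducible {ϖ : R} (hϖ : Irreducible ϖ) : ρ ϖ = 0 := by
  by_contra h
  exact hϖ.not_isUnit ((isUnit_iff_map_ne_zero ρ).2 h)

/-- The residue map of the ring of pairs of congruent elements. -/
def congruentPairsResidue (a : R) : congruentPairs a →+* κ :=
  ρ.comp ((RingHom.fst R R).comp (congruentPairs a).subtype)

lemma isLocalHom_congruentPairsResidue {a : R} (ha : ρ a = 0) :
    IsLocalHom (congruentPairsResidue ρ a) where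
  map_nonunit := by
    rintro ⟨⟨y, z⟩, h⟩ hu
    have h1 : ρ y ≠ 0 := hu.ne_zero
    have h2 : ρ z ≠ 0 := by
      obtain ⟨q, hq⟩ := mem_congruentPairs.1 h
      rw [sub_eq_iff_eq_add] at hq
      simp only at hq
      rwa [hq, map_add, map_mul, ha, zero_mul, zero_add] at h1
    obtain ⟨y', hy⟩ := ((isUnit_iff_map_ne_zero ρ).2 h1).exists_right_inv
    obtain ⟨z', hz⟩ := ((isUnit_iff_map_ne_zero ρ).2 h2).exists_right_inv
    have h' : a ∣ y' - z' := by
      have : y' - z' = (y - z) * (-(y' * z')) := by linear_combination (z' * hy - y' * hz)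
      rw [this]
      exact (mem_congruentPairs.1 h).mul_right _
    exact IsUnit.of_mul_eq_one ⟨(y', z'), h'⟩ (Subtype.ext (Prod.ext hy hz))

/-- The residue map of the ring of dual numbers over a quotient of `R`. -/
def dualNumberResidue (I : Ideal R) (hI : ∀ a ∈ I, ρ a = 0) : DualNumber (R ⧸ I) →+* κ :=
  (Ideal.Quotient.lift I ρ hI).comp (TrivSqZeroExt.fstHom (R ⧸ I) (R ⧸ I) (R ⧸ I)).toRingHom

lemma isLocalHom_dualNumberResidue (I : Ideal R) (hI : ∀ a ∈ I, ρ a = 0) :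
    IsLocalHom (dualNumberResidue ρ I hI) where
  map_nonunit z hz := by
    rw [TrivSqZeroExt.isUnit_iff_isUnit_fst]
    obtain ⟨r, hr⟩ := Ideal.Quotient.mk_surjective z.fst
    rw [← hr]
    refine IsUnit.map _ ((isUnit_iff_map_ne_zero ρ).2 ?_)
    have : dualNumberResidue ρ I hI z = Ideal.Quotient.lift I ρ hI z.fst := rfl
    rw [this, ← hr, Ideal.Quotient.lift_mk] at hz
    exact hz.ne_zero

end LocalRings

section Return

variable {Λ A κ ι R : Type*} [CommRing Λ] [CommRing A] [Field κ] {x : ι → A →+* κ}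
  {σ : ℕ → ι} {φ : ∀ j, A →+* LocalRingAt (x j)}
  [CommRing R] [IsDomain R] [IsDiscreteValuationRing R]

/-- Some power of the return map is close to translations. -/
lemma IsOrbit.exists_near_translation [Finite (IsLocalRing.ResidueField R)]
    (ρ : R →+* κ) [IsLocalHom ρ] {m : ℕ} (hσ : Function.Periodic σ m)
    (hφ : ∀ i, (evalAt _).comp (φ (σ i)) = x (σ (i + 1)))
    (hunr : ∀ j, (φ j).FormallyUnramified) {c : Λ →+* A} (hfin : c.FiniteType)
    (hc : ∀ j, (φ j).comp c = (algebraMap A _).comp c) (cR : Λ →+* R)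
    {ϖ : R} (hϖ : Irreducible ϖ) {J : ℕ} (hJ : J ≠ 0) :
    ∃ M, 0 < M ∧ ∀ u u' : ℕ → A →+* R, IsOrbit σ φ u → IsOrbit σ φ u' →
      ρ.comp (u 0) = x (σ 0) → ρ.comp (u' 0) = x (σ 0) → (u 0).comp c = cR → (u' 0).comp c = cR →
      ∀ l, J ≤ l → (∀ a, ϖ ^ l ∣ u 0 a - u' 0 a) → ∀ a,
        ϖ ^ (l + J) ∣ (u (m * M) a - u' (m * M) a) - (u 0 a - u' 0 a) ∧
        ϖ ^ J ∣ u' (m * M) a - u' 0 a := by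
  let I : Ideal R := Ideal.span {ϖ ^ J}
  have hρI : ∀ a ∈ I, ρ a = 0 := fun a ha ↦ by
    obtain ⟨b, rfl⟩ := Ideal.mem_span_singleton.1 ha
    rw [map_mul, map_pow, map_eq_zero_of_irreducible ρ hϖ, zero_pow hJ, zero_mul]
  have : Finite (R ⧸ I) := IsLocalRing.finite_quotient_iff.2
    ⟨J, by rw [hϖ.maximalIdeal_eq, Ideal.span_singleton_pow]⟩
  have : Finite (DualNumber (R ⧸ I)) := inferInstanceAs (Finite ((R ⧸ I) × (R ⧸ I)))
  have := isLocalHom_dualNumberResidue ρ I hρI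
  let cB : Λ →+* DualNumber (R ⧸ I) :=
    (TrivSqZeroExt.inlHom (R ⧸ I) (R ⧸ I)).comp ((Ideal.Quotient.mk I).comp cR)
  obtain ⟨M, hM0, hM⟩ := IsOrbit.exists_return_eq (dualNumberResidue ρ I hρI) hσ hφ hunr hc cB
    (finite_ringHom_of_finiteType hfin cB)
  refine ⟨M, hM0, fun u u' hu hu' h0 h0' hc0 hc0' l hl hd a ↦ ?_⟩
  have hϖl : ρ (ϖ ^ l) = 0 := by
    rw [map_pow, map_eq_zero_of_irreducible ρ hϖ, zero_pow (by omega)]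
  have hlI : ϖ ^ l ∈ I := Ideal.mem_span_singleton.2 (pow_dvd_pow ϖ hl)
  have hl0 : ϖ ^ l ≠ 0 := pow_ne_zero _ hϖ.ne_zero
  have := isLocalHom_congruentPairsResidue ρ hϖl
  -- The two points are moved as one point over the ring of congruent pairs; by uniqueness the
  -- projections of its orbit are `u` and `u'`.
  obtain ⟨U, hU0, hU⟩ := IsOrbit.exists_orbit (σ := σ) (φ := φ) (congruentPairsResidue ρ (ϖ ^ l)) hφ
    (((u 0).prod (u' 0)).codRestrict (congruentPairs (ϖ ^ l)) hd) h0
  have h1 := (hU.map ((RingHom.fst R R).comp (congruentPairs (ϖ ^ l)).subtype)).unique hu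
    (by rw [hU0]; rfl)
  have h2 := (hU.map ((RingHom.snd R R).comp (congruentPairs (ϖ ^ l)).subtype)).unique hu'
    (by rw [hU0]; rfl)
  have h3 := hM _ (hU.map (dividedDifference hl0 hlI))
    (by
      rw [← h0', ← RingHom.comp_assoc, hU0]
      ext b
      change Ideal.Quotient.lift I ρ hρI (dividedDifference hl0 hlI _).fst = _
      rw [fst_dividedDifference]
      rfl)
    (by
      rw [hU0]
      refine RingHom.ext fun b ↦ (dividedDifference_of_eq hl0 hlI ?_).trans ?_
      · exact congr($(hc0.trans hc0'.symm) b)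
      · exact congr(TrivSqZeroExt.inl (Ideal.Quotient.mk I ($hc0' b))))
  have h4 := congr($h3 a)
  simp only [RingHom.comp_apply] at h4
  have e1 (n : ℕ) : (U n a).1.1 = u n a := congr($h1 n a)
  have e2 (n : ℕ) : (U n a).1.2 = u' n a := congr($h2 n a)
  -- The `ε`-part of the return identity controls the differences, its constant part the
  -- displacement of `u'`.
  constructor
  · have := dvd_of_dividedDifference_eq hl0 hlI h4
    rwa [← pow_add, e1, e1, e2, e2] at this
  · have := congr(TrivSqZeroExt.fst $h4)
    rwa [fst_dividedDifference, fst_dividedDifference, e2, e2, Ideal.Quotient.eq,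
      Ideal.mem_span_singleton] at this

/-- The periods of the preperiodic orbits of integral points with a given reduction are bounded. -/
theorem IsOrbit.exists_period_bound [CharZero R] [Finite (IsLocalRing.ResidueField R)]
    (ρ : R →+* κ) [IsLocalHom ρ] {m : ℕ} (hσ : Function.Periodic σ m)
    (hm : 0 < m) (hφ : ∀ i, (evalAt _).comp (φ (σ i)) = x (σ (i + 1)))
    (hunr : ∀ j, (φ j).FormallyUnramified) {c : Λ →+* A} (hfin : c.FiniteType)
    (hc : ∀ j, (φ j).comp c = (algebraMap A _).comp c) (cR : Λ →+* R) :
    ∃ N, 0 < N ∧ ∀ u : ℕ → A →+* R, IsOrbit σ φ u → ρ.comp (u 0) = x (σ 0) →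
      (u 0).comp c = cR → (∃ i j, i < j ∧ ∀ s, u (i + s) = u (j + s)) → u N = u 0 := by
  obtain ⟨ϖ, hϖ⟩ := IsDiscreteValuationRing.exists_irreducible R
  obtain ⟨J, hJ⟩ := exists_pow_not_dvd_prime hϖ
  have hJ0 : J ≠ 0 := by
    rintro rfl
    exact hJ 2 Nat.prime_two (by simp)
  obtain ⟨M, hM0, hM⟩ := IsOrbit.exists_near_translation ρ hσ hφ hunr hfin hc cR hϖ hJ0
  refine ⟨m * M, Nat.mul_pos hm hM0, fun u hu h0 hc0 ⟨i, j, hij, hs⟩ ↦ ?_⟩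
  have hsh (k : ℕ) : IsOrbit σ φ (fun i ↦ u (i + m * (M * k))) := hu.shift hσ _
  have hσ' (k : ℕ) : σ (0 + m * k) = σ 0 := by simpa [mul_comm] using hσ.nat_mul k 0
  have hsh0 (k : ℕ) : ρ.comp (u (0 + m * (M * k))) = x (σ 0) := by
    rw [hu.comp_eq ρ hφ h0, hσ']
  have hshc (k : ℕ) : (u (0 + m * (M * k))).comp c = cR := by rw [hu.comp_const hc, hc0]
  -- The orbit sampled at multiples of `m * M`, the coordinates being all of `A`.
  let w : ℕ → A → R := fun k a ↦ u (0 + m * (M * k)) a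
  have hsucc (k : ℕ) : m * M + m * (M * k) = 0 + m * (M * (k + 1)) := by ring
  have hw : NearTranslation ϖ J w := fun a b l hl h z ↦ by
    have := (hM _ _ (hsh a) (hsh b) (hsh0 a) (hsh0 b) (hshc a) (hshc b) l hl h z).1
    simp only [hsucc] at this
    exact this
  have hstep (k : ℕ) (z : A) : ϖ ^ J ∣ w (k + 1) z - w k z := by
    have := (hM _ _ (hsh k) (hsh k) (hsh0 k) (hsh0 k) (hshc k) (hshc k) J le_rfl (by simp) z).2
    simp only [hsucc] at this
    exact this
  have hw0 (k : ℕ) (z : A) : ϖ ^ J ∣ w k z - w 0 z := by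
    induction k with
    | zero => simp
    | succ k ih => simpa using dvd_add (hstep k z) ih
  have hper (a n : ℕ) (ha : i ≤ a) : u (a + (j - i) * n) = u a := by
    induction n with
    | zero => rfl
    | succ n ih =>
      rw [← ih]
      have := hs (a + (j - i) * n - i)
      rw [show i + (a + (j - i) * n - i) = a + (j - i) * n by omega] at this
      rw [this]
      congr 1
      rw [Nat.mul_succ]
      omega
  -- At time `m * M * i ≥ i` the orbit has period `j - i`, hence also `m * M * (j - i)`, a multiple
  -- of `m`. Injectivity, with Krull's intersection theorem, carries this back to time 0: `w` has
  -- period `j - i`.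
  have hinj := (hsh (j - i)).injective hu ρ
    (Ideal.iInf_pow_eq_bot_of_isDomain _ (RingHom.ker_ne_top ρ)) hφ hunr (hsh0 _) h0
    (n := m * M * i) (by
      have := hper (m * M * i) (m * M) (Nat.le_mul_of_pos_left i (Nat.mul_pos hm hM0))
      rw [← this]
      congr 1
      ring)
  have huniq := (hsh (j - i)).unique hu hinj
  have := hw.eq_of_periodic hϖ
    (fun a b z ↦ by simpa using dvd_sub (hw0 a z) (hw0 b z)) hJ (d := j - i) (by omega)
    (fun k ↦ by
      funext z
      have := congr($huniq (m * (M * k)) z)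
      simp only at this
      simp only [w, zero_add]
      rw [← this]
      congr 2
      ring) 0
  ext z
  simpa [w] using congr_fun this z

end Return

/-! ### Unramified maps and their reductions -/

section Unramified

/-- An algebra `S` essentially of finite type over `A` is formally unramified if it is so modulo an
ideal of `A` that generates a proper ideal of the local ring `S`. -/
lemma formallyUnramified_of_quotient {A S : Type*} [CommRing A] [CommRing S] [IsLocalRing S]
    [Algebra A S] [Algebra.EssFiniteType A S] (I : Ideal A)
    (hI : I.map (algebraMap A S) ≤ IsLocalRing.maximalIdeal S)
    [Algebra.FormallyUnramified A (S ⧸ I.map (algebraMap A S))] :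
    Algebra.FormallyUnramified A S := by
  set Q := I.map (algebraMap A S) with hQ
  let M := Ω[S⁄A] ⧸ (Q • ⊤ : Submodule S Ω[S⁄A])
  let d : Derivation A S M := (Submodule.mkQ (Q • ⊤)).compDer (KaehlerDifferential.D A S)
  have hQM (s : S) (hs : s ∈ Q) (z : M) : s • z = 0 := by
    obtain ⟨z, rfl⟩ := Submodule.mkQ_surjective _ z
    rw [← map_smul]
    exact (Submodule.Quotient.mk_eq_zero _).2 (Submodule.smul_mem_smul hs trivial)
  -- On `Q`, `d` vanishes: its generators come from `A`, and the other Leibniz term lies in `Q M =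
  -- 0`. So `d` descends to `S ⧸ Q`, where every derivation over `A` is zero; thus `Ω = Q Ω`, and
  -- Nakayama applies because `Ω` is finite.
  have hd (s : S) (hs : s ∈ Submodule.span S (algebraMap A S '' I)) : d s = 0 := by
    induction hs using Submodule.span_induction with
    | mem s h =>
      obtain ⟨a, -, rfl⟩ := h
      exact d.map_algebraMap a
    | zero => exact map_zero d
    | add s t _ _ h1 h2 => rw [map_add, h1, h2, add_zero]
    | smul r s h1 h2 => rw [smul_eq_mul, d.leibniz, h2, smul_zero, zero_add, hQM s h1]
  let d' : (S ⧸ Q) →ₗ[A] M := Submodule.liftQ (Q.restrictScalars A) d.toLinearMap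
    (fun s hs ↦ hd s hs)
  have hd' (s : S) : d' (Ideal.Quotient.mk Q s) = d s := rfl
  let D : Derivation A (S ⧸ Q) M := Derivation.mk' d' fun a b ↦ by
    obtain ⟨a, rfl⟩ := Ideal.Quotient.mk_surjective a
    obtain ⟨b, rfl⟩ := Ideal.Quotient.mk_surjective b
    rw [← map_mul, hd', hd', hd', d.leibniz]
    rfl
  have hD (a : S ⧸ Q) : D a = 0 := by
    rw [← D.liftKaehlerDifferential_comp_D,
      Subsingleton.elim (KaehlerDifferential.D A (S ⧸ Q) a) 0, map_zero]
  have hle : (⊤ : Submodule S Ω[S⁄A]) ≤ Q • ⊤ := by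
    rw [← KaehlerDifferential.span_range_derivation, Submodule.span_le]
    rintro _ ⟨s, rfl⟩
    rw [KaehlerDifferential.span_range_derivation]
    exact (Submodule.Quotient.mk_eq_zero _).1 (hD (Ideal.Quotient.mk Q s))
  have := Submodule.eq_bot_of_le_smul_of_le_jacobson_bot Q ⊤ Module.Finite.fg_top hle
    (by rwa [IsLocalRing.jacobson_eq_maximalIdeal _ bot_ne_top])
  exact ⟨(Submodule.subsingleton_iff S).1 (subsingleton_of_bot_eq_top this.symm)⟩

lemma essFiniteType_comp {R S T : Type*} [CommRing R] [CommRing S] [CommRing T] {f : R →+* S}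
    {g : S →+* T} (hf : f.EssFiniteType) (hg : g.EssFiniteType) : (g.comp f).EssFiniteType := by
  algebraize [f, g, g.comp f]
  exact Algebra.EssFiniteType.comp R S T

lemma essFiniteType_of_comp {R S T : Type*} [CommRing R] [CommRing S] [CommRing T] {f : R →+* S}
    {g : S →+* T} (h : (g.comp f).EssFiniteType) : g.EssFiniteType := by
  algebraize [f, g, g.comp f]
  exact Algebra.EssFiniteType.of_comp R S T

/-- If the reduction of `φ` modulo `P` is unramified and `φ` fixes the constants, from which `P` is
generated, then `φ` is unramified. -/
lemma formallyUnramified_of_reduction {Λ A κ : Type*} [CommRing Λ] [CommRing A] [Field κ]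
    {x : A →+* κ} {φ : A →+* LocalRingAt x} {c : Λ →+* A} (hfin : c.FiniteType)
    (hc : φ.comp c = (algebraMap A _).comp c) (p : Ideal Λ) (hp : ∀ a ∈ p, x (c a) = 0)
    (h : ((Ideal.Quotient.mk ((p.map c).map (algebraMap A (LocalRingAt x)))).comp
      φ).FormallyUnramified) : φ.FormallyUnramified := by
  -- Because `φ` fixes the constants, the ideal of the closed fibre is also extended from `A` along
  -- `φ`.
  have e : (p.map c).map (algebraMap A (LocalRingAt x)) = (p.map c).map φ := by
    rw [Ideal.map_map, Ideal.map_map, hc]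
  have hle : (p.map c).map (algebraMap A (LocalRingAt x)) ≤
      IsLocalRing.maximalIdeal (LocalRingAt x) := by
    rw [← Localization.AtPrime.map_eq_maximalIdeal]
    exact Ideal.map_mono (Ideal.map_le_iff_le_comap.2 fun a ha ↦ hp a ha)
  have hess : φ.EssFiniteType := by
    refine essFiniteType_of_comp (f := c) (hc ▸ essFiniteType_comp hfin.essFiniteType ?_)
    exact RingHom.essFiniteType_algebraMap.2 (.of_isLocalization _ (RingHom.ker x).primeCompl)
  rw [e] at h hle
  let _ := φ.toAlgebra
  have : Algebra.EssFiniteType A (LocalRingAt x) := hess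
  have : Algebra.FormallyUnramified A
    (LocalRingAt x ⧸ (p.map c).map (algebraMap A (LocalRingAt x))) := h
  exact formallyUnramified_of_quotient (p.map c) hle

end Unramified

/-! ### Values of rational maps -/

section Values

lemma isSeparated_of_over_affine {X S : Scheme.{u}} [IsAffine S] [X.Over S]
    [IsSeparated (X ↘ S)] : X.IsSeparated := ⟨by
  rw [← Limits.terminal.comp_from (X ↘ S)]
  infer_instance⟩

/-- On a reduced separated scheme all representatives are restrictions of the one on the largest
domain. -/
lemma MapsTo.unique {X : Scheme.{u}} [IsReduced X] [X.IsSeparated] {f : X.RationalMap X}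
    {T : Scheme.{u}} {a b b' : T ⟶ X} (h : MapsTo f a b) (h' : MapsTo f a b') : b = b' := by
  have key {b : T ⟶ X} (h : MapsTo f a b) : ∃ d : T ⟶ f.domain.toScheme, d ≫ f.domain.ι = a ∧
      b = d ≫ f.toPartialMap.hom := by
    obtain ⟨g, rfl, a', h1, h2⟩ := h
    refine ⟨a' ≫ X.homOfLE g.le_domain_toRationalMap, by simpa using h1, ?_⟩
    rw [← h2, ← g.toPartialMap_toRationalMap_restrict]
    exact (Category.assoc _ _ _).symm
  obtain ⟨d, h1, h2⟩ := key h
  obtain ⟨d', h1', h2'⟩ := key h'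
  obtain rfl : d = d' := by rw [← cancel_mono f.domain.ι, h1, h1']
  rw [h2, h2']

lemma IterMapsTo.unique {X : Scheme.{u}} [IsReduced X] [X.IsSeparated] {f : X.RationalMap X}
    {T : Scheme.{u}} {i : ℕ} {a b b' : T ⟶ X} (h : IterMapsTo f i a b) (h' : IterMapsTo f i a b') :
    b = b' := by
  induction i generalizing b b' with
  | zero => exact h.symm.trans h'
  | succ i ih =>
    obtain ⟨c, h1, h2⟩ := h
    obtain ⟨c', h1', h2'⟩ := h'
    obtain rfl := ih h1 h1'
    exact h2.unique h2'

end Values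

/-! ### Points of the chart and the pull-back of functions -/

namespace Chart

variable {k : Type u} [Field k] {X : Scheme.{u}} [X.Over (Spec (.of k))] {n r : ℕ}
  (C : Chart k X n r)

lemma toPoint_injective {L : Type u} [Field L] {t t' : Γ(X, C.U) →+* L}
    (h : C.toPoint t = C.toPoint t') : t = t' := by
  rw [toPoint, toPoint, cancel_mono] at h
  exact congr(CommRingCat.Hom.hom $(Spec.map_injective h))

lemma fromSpec_over : C.isAffineOpen.fromSpec ≫ (X ↘ Spec (.of k)) =
    Spec.map (CommRingCat.ofHom (constants k X C.U)) := by
  rw [← (isAffineOpen_top _).SpecMap_appLE_fromSpec (X ↘ Spec (.of k)) C.isAffineOpen le_top,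
    IsAffineOpen.fromSpec_top, Scheme.isoSpec_Spec_inv, ← Spec.map_comp]
  rfl

/-- As `f` is a map over `k`, the generic point and its image under `f` lie over the same point of
`Spec k`. -/
lemma pullback_comp_constants [IsIntegral X] {f : X.RationalMap X} [f.IsOver (Spec (.of k))]
    {g : Γ(X, C.U) →+* X.functionField} (hg : C.IsPullback f g) :
    g.comp (constants k X C.U) = (X.germToFunctionField C.U).hom.comp (constants k X C.U) := by
  have hf := (Scheme.RationalMap.isOver_iff (S := Spec (.of k)) (f := f)).1 inferInstance
  have h1 : f.fromFunctionField ≫ (X ↘ Spec (.of k)) =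
      X.fromSpecStalk _ ≫ (X ↘ Spec (.of k)) := by
    obtain ⟨f, rfl⟩ := f.exists_rep
    simpa [Scheme.RationalMap.fromFunctionField_toRationalMap] using!
      congr(Scheme.RationalMap.fromFunctionField $hf)
  have h2 : X.fromSpecStalk (genericPoint X) =
      Spec.map (X.germToFunctionField C.U) ≫ C.isAffineOpen.fromSpec :=
    (C.isAffineOpen.fromSpecStalk_eq_fromSpecStalk _).symm
  have key (G G' : Γ(X, C.U) ⟶ X.functionField)
      (h : (Spec.map G ≫ C.isAffineOpen.fromSpec) ≫ (X ↘ Spec (.of k)) =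
        (Spec.map G' ≫ C.isAffineOpen.fromSpec) ≫ (X ↘ Spec (.of k))) :
      CommRingCat.ofHom (constants k X C.U) ≫ G = CommRingCat.ofHom (constants k X C.U) ≫ G' := by
    rw [Category.assoc, Category.assoc, C.fromSpec_over, ← Spec.map_comp, ← Spec.map_comp] at h
    exact Spec.map_injective h
  rw [h2, hg] at h1
  exact congr(CommRingCat.Hom.hom $(key _ _ h1))

/-- Let `ψ` be a ring homomorphism from `Γ(X, U)` to the functions on the basic open subset of `U`
where `s` does not vanish, which induces the pull-back under `f`.  Then `f` is defined by `ψ` at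
the points where `s` does not vanish. -/
lemma exists_mapsTo [IsIntegral X] {f : X.RationalMap X}
    {g : Γ(X, C.U) →+* X.functionField} (hg : C.IsPullback f g) (s : Γ(X, C.U))
    [Nonempty (X.basicOpen s)] (ψ : Γ(X, C.U) →+* Γ(X, X.basicOpen s))
    (hψ : (X.germToFunctionField (X.basicOpen s)).hom.comp ψ = g)
    {L : Type u} [Field L] (t : Γ(X, X.basicOpen s) →+* L) :
    MapsTo f (C.toPoint (t.comp (algebraMap _ _))) (C.toPoint (t.comp ψ)) := by
  have hD : IsAffineOpen (X.basicOpen s) := C.isAffineOpen.basicOpen s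
  let G : X.PartialMap X :=
    { domain := X.basicOpen s
      dense_domain := (X.basicOpen s).2.dense (Set.nonempty_coe_sort.1 ‹_›)
      hom := (X.basicOpen s).toSpecΓ ≫ Spec.map (CommRingCat.ofHom ψ) ≫ C.isAffineOpen.fromSpec }
  refine ⟨G, ?_, Spec.map (CommRingCat.ofHom t) ≫ hD.isoSpec.inv, ?_, ?_⟩
  · apply Scheme.RationalMap.eq_of_fromFunctionField_eq
    rw [hg, Scheme.RationalMap.fromFunctionField_toRationalMap]
    change (X.basicOpen s).fromSpecStalkOfMem _ _ ≫ (X.basicOpen s).toSpecΓ ≫ _ = _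
    rw [Scheme.Opens.fromSpecStalkOfMem_toSpecΓ_assoc, ← Spec.map_comp_assoc, ← hψ]
    rfl
  · change (Spec.map (CommRingCat.ofHom t) ≫ hD.isoSpec.inv) ≫ (X.basicOpen s).ι = _
    rw [Category.assoc, hD.isoSpec_inv_ι, toPoint,
      ← C.isAffineOpen.map_fromSpec hD (homOfLE (X.basicOpen_le s)).op, ← Spec.map_comp_assoc]
    rfl
  · change (Spec.map (CommRingCat.ofHom t) ≫ hD.isoSpec.inv) ≫ (X.basicOpen s).toSpecΓ ≫ _ = _
    rw [← hD.isoSpec_hom, Category.assoc, Iso.inv_hom_id_assoc, ← Spec.map_comp_assoc]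
    rfl

end Chart

section ToField

variable {A F κ : Type*} [CommRing A] [Field F] [Field κ]

lemma toField_algebraMap {ι : A →+* F} (hι : Function.Injective ι) (x : A →+* κ) (a : A) :
    toField hι x (algebraMap A _ a) = ι a :=
  IsLocalization.lift_eq _ _

lemma toField_injective [IsDomain A] {ι : A →+* F} (hι : Function.Injective ι) (x : A →+* κ) :
    Function.Injective (toField hι x) := by
  refine (IsLocalization.lift_injective_iff _).2 fun a b ↦ ?_
  rw [hι.eq_iff, (IsLocalization.injective (LocalRingAt x)
    (RingHom.ker x).primeCompl_le_nonZeroDivisors).eq_iff]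

end ToField

/-! ### The integral model and the values of `f` near `x` -/

namespace Chart

variable {k : Type u} [Field k] {X : Scheme.{u}} [X.Over (Spec (.of k))] {n r : ℕ}
  (C : Chart k X n r)

/-- The coordinates as elements of the coordinate ring of the integral model. -/
def modelCoord (i : Fin n ⊕ Fin r) : C.model :=
  ⟨C.coord i, MvPolynomial.X i, by simp⟩

lemma coe_modelConstants (a : 𝓞 k) :
    (C.modelConstants a : Γ(X, C.U)) = constants k X C.U (algebraMap (𝓞 k) k a) :=
  MvPolynomial.eval₂Hom_C _ _ _

lemma modelConstants_finiteType : C.modelConstants.FiniteType :=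
  RingHom.FiniteType.comp (RingHom.FiniteType.of_surjective _ (RingHom.rangeRestrict_surjective _))
    (RingHom.finiteType_algebraMap.2 inferInstance)

lemma induction_on {p : Γ(X, C.U) → Prop} (u : Γ(X, C.U)) (hc : ∀ a, p (constants k X C.U a))
    (hx : ∀ i, p (C.coord i)) (hadd : ∀ a b, p a → p b → p (a + b))
    (hmul : ∀ a b, p a → p b → p (a * b)) : p u := by
  obtain ⟨q, rfl⟩ := C.generate u
  induction q using MvPolynomial.induction_on with
  | C a => simpa using hc a
  | add a b ha hb => simpa using hadd _ _ ha hb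
  | mul_X a i ha => simpa using hmul _ _ ha (hx i)

lemma model_induction_on {p : Γ(X, C.U) → Prop} (u : C.model)
    (hc : ∀ a, p (constants k X C.U (algebraMap (𝓞 k) k a)))
    (hx : ∀ i, p (C.coord i)) (hadd : ∀ a b, p a → p b → p (a + b))
    (hmul : ∀ a b, p a → p b → p (a * b)) : p u := by
  obtain ⟨_, q, rfl⟩ := u
  induction q using MvPolynomial.induction_on with
  | C a => simpa using hc a
  | add a b ha hb => simpa using hadd _ _ ha hb
  | mul_X a i ha => simpa using hmul _ _ ha (hx i)

/-- The model contains the coordinates, and `k` is the fraction field of `𝓞 k`. -/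
lemma ringHom_ext_of_model [NumberField k] {L : Type*} [CommRing L] {t t' : Γ(X, C.U) →+* L}
    (h : ∀ a : C.model, t a = t' a) : t = t' := by
  have hk : t.comp (constants k X C.U) = t'.comp (constants k X C.U) := by
    refine IsLocalization.ringHom_ext (nonZeroDivisors (𝓞 k)) (RingHom.ext fun a ↦ ?_)
    have := h (C.modelConstants a)
    rwa [coe_modelConstants] at this
  ext u
  induction u using C.induction_on with
  | hc a => exact congr($hk a)
  | hx i => exact h (C.modelCoord i)
  | hadd a b ha hb => rw [map_add, map_add, ha, hb]
  | hmul a b ha hb => rw [map_mul, map_mul, ha, hb]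

/-- If `f` is given near `x` by `φ`, and `t` is a point of `U` that reduces to `x`, then `f (t)` is
the point of `U` given by `φ`. -/
lemma exists_mapsTo_of_local [IsIntegral X] {f : X.RationalMap X} [f.IsOver (Spec (.of k))]
    {g : Γ(X, C.U) →+* X.functionField} (hg : C.IsPullback f g)
    {κ : Type*} [Field κ] {x : C.model →+* κ} {φ : C.model →+* LocalRingAt x}
    (hφ : ∀ a, toField C.modelToField_injective x (φ a) = g a)
    {L : Type u} [Field L] (t : Γ(X, C.U) →+* L) (l : LocalRingAt x →+* L)
    (hl : ∀ a : C.model, l (algebraMap _ _ a) = t a) :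
    ∃ t' : Γ(X, C.U) →+* L, MapsTo f (C.toPoint t) (C.toPoint t') ∧
      ∀ a : C.model, t' a = l (φ a) := by
  have hunit (s : (RingHom.ker x).primeCompl) : t s ≠ 0 := by
    rw [← hl]
    exact ((IsLocalization.map_units (LocalRingAt x) s).map l).ne_zero
  -- A common denominator of the finitely many `φ (x_i)`: `f` is then given by functions on the
  -- basic open set of `s`, which contains `t`.
  obtain ⟨s, hs⟩ := IsLocalization.exist_integer_multiples_of_finite (RingHom.ker x).primeCompl
    (fun i ↦ φ (C.modelCoord i))
  choose b hb using hs
  let D := X.basicOpen (s : Γ(X, C.U))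
  have hloc : IsLocalization.Away (s : Γ(X, C.U)) Γ(X, D) :=
    C.isAffineOpen.isLocalization_basicOpen _
  have hD : Nonempty D := by
    refine Set.nonempty_coe_sort.2 (Set.nonempty_iff_ne_empty.2 fun h ↦ hunit s ?_)
    rw [(basicOpen_eq_bot_iff _).1 (TopologicalSpace.Opens.ext h), map_zero]
  let γ : Γ(X, D) →+* X.functionField := (X.germToFunctionField D).hom
  have hγ : Function.Injective γ := X.germToFunctionField_injective D
  have hγU (a : Γ(X, C.U)) : γ (algebraMap _ _ a) = X.germToFunctionField C.U a :=
    congr((CommRingCat.Hom.hom $(X.presheaf.germ_res (homOfLE (X.basicOpen_le (s : Γ(X, C.U))))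
      (genericPoint X) (((genericPoint_spec X).mem_open_set_iff D.isOpen).2
        (by simpa using Set.nonempty_coe_sort.1 hD)))) a)
  have hγm (a : C.model) : γ (algebraMap _ _ (a : Γ(X, C.U))) = C.modelToField a := hγU a
  have hrange (u : Γ(X, C.U)) : g u ∈ γ.range := by
    induction u using C.induction_on with
    | hc a =>
      refine ⟨algebraMap _ _ (constants k X C.U a), ?_⟩
      rw [hγU]
      exact congr($((C.pullback_comp_constants hg).symm) a)
    | hx i =>
      obtain ⟨s', hs'⟩ := (IsLocalization.Away.algebraMap_isUnit (S := Γ(X, D))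
        (s : Γ(X, C.U))).exists_right_inv
      refine ⟨algebraMap _ _ (b i : Γ(X, C.U)) * s', ?_⟩
      have h1 := congr(toField C.modelToField_injective x $(hb i))
      rw [Algebra.smul_def, map_mul, hφ, toField_algebraMap, toField_algebraMap] at h1
      rw [map_mul, hγm, h1, ← hγm, mul_right_comm, ← map_mul, hs', map_one, one_mul]
      rfl
    | hadd a b ha hb => rw [map_add]; exact add_mem ha hb
    | hmul a b ha hb => rw [map_mul]; exact mul_mem ha hb
  let e : Γ(X, D) ≃+* γ.range := RingEquiv.ofBijective γ.rangeRestrict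
    ⟨fun _ _ h ↦ hγ congr($(h).1), γ.rangeRestrict_surjective⟩
  let ψ : Γ(X, C.U) →+* Γ(X, D) := e.symm.toRingHom.comp (g.codRestrict γ.range hrange)
  have hψ (u : Γ(X, C.U)) : γ (ψ u) = g u :=
    congr($(e.apply_symm_apply (g.codRestrict γ.range hrange u)).1)
  let tD : Γ(X, D) →+* L := IsLocalization.Away.lift (s : Γ(X, C.U)) (hunit s).isUnit
  have htD : tD.comp (algebraMap _ _) = t := IsLocalization.Away.lift_comp _ _
  refine ⟨tD.comp ψ, ?_, fun a ↦ ?_⟩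
  · have := C.exists_mapsTo hg (s : Γ(X, C.U)) ψ (RingHom.ext hψ) tD
    rwa [htD] at this
  -- Write `φ a = b / s'`. The relation passes through the function field to the basic open set,
  -- where evaluating at `t` and cancelling `t s' ≠ 0` identifies both values.
  · obtain ⟨⟨b, s'⟩, hb⟩ := IsLocalization.surj (RingHom.ker x).primeCompl (φ a)
    have h1 := congr(l $hb)
    have h2 := congr(toField C.modelToField_injective x $hb)
    rw [map_mul, hl, hl] at h1
    rw [map_mul, hφ, toField_algebraMap, toField_algebraMap, ← hψ, ← hγm, ← hγm, ← map_mul,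
      hγ.eq_iff] at h2
    have h3 := congr(tD $h2)
    rw [map_mul] at h3
    have h4 (u : Γ(X, C.U)) : tD (algebraMap _ _ u) = t u := congr($htD u)
    rw [h4, h4, ← h1] at h3
    exact mul_right_cancel₀ (hunit s') h3

end Chart

/-! ### The completions of a number field -/

section Completion

variable {K : Type*} [Field K] [NumberField K] (v : HeightOneSpectrum (𝓞 K))

instance : CharZero (v.adicCompletionIntegers K) where
  cast_injective a b h := by
    have : CharZero (v.adicCompletion K) :=
      charZero_of_injective_algebraMap (algebraMap K (v.adicCompletion K)).injective
    have := congr(((v.adicCompletionIntegers K).subtype $h))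
    simpa using this

lemma residue_eq_zero_iff_valued_lt_one {a : v.adicCompletionIntegers K} :
    IsLocalRing.residue (v.adicCompletionIntegers K) a = 0 ↔
      Valued.v (a : v.adicCompletion K) < 1 := by
  rw [IsLocalRing.residue_eq_zero_iff, IsLocalRing.mem_maximalIdeal, mem_nonunits_iff,
    HeightOneSpectrum.adicCompletionIntegers.isUnit_iff_valued_eq_one]
  exact ⟨fun h ↦ lt_of_le_of_ne a.2 h, fun h ↦ h.ne⟩

lemma residue_algebraMap_eq_zero {a : 𝓞 K} (ha : a ∈ v.asIdeal) :
    IsLocalRing.residue _ (algebraMap (𝓞 K) (v.adicCompletionIntegers K) a) = 0 := by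
  rw [residue_eq_zero_iff_valued_lt_one,
    HeightOneSpectrum.algebraMap_adicCompletionIntegers_apply,
    HeightOneSpectrum.valuedAdicCompletion_eq_valuation']
  exact (v.valuation_lt_one_iff_mem a).2 ha

instance : Finite (IsLocalRing.ResidueField (v.adicCompletionIntegers K)) := by
  have : Finite (𝓞 K ⧸ v.asIdeal) := Ideal.finiteQuotientOfFreeOfNeBot _ v.ne_bot
  let F : 𝓞 K →+* IsLocalRing.ResidueField (v.adicCompletionIntegers K) :=
    (IsLocalRing.residue _).comp (algebraMap (𝓞 K) (v.adicCompletionIntegers K))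
  refine Finite.of_surjective
    (Ideal.Quotient.lift v.asIdeal F fun a ha ↦ residue_algebraMap_eq_zero v ha)
    (Ideal.Quotient.lift_surjective_of_surjective _ _ fun z ↦ ?_)
  obtain ⟨z, rfl⟩ := IsLocalRing.residue_surjective z
  -- Surjectivity of `𝓞 K` onto the residue field: approximate first by `K`, which is dense, then by
  -- an algebraic integer.
  obtain ⟨b, hb⟩ : ∃ b : K, Valued.v (algebraMap K (v.adicCompletion K) b - z) < 1 := by
    obtain ⟨b, hb⟩ := (HeightOneSpectrum.denseRange_algebraMap K v).exists_mem_open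
      ((Valued.isOpen_ball _ 1).preimage (continuous_id.sub (continuous_const (y := z.1))))
      ⟨z, by simp⟩
    exact ⟨b, (Valuation.restrict_lt_one_iff _).1 hb⟩
  have hb1 : v.valuation K b ≤ 1 := by
    rw [← HeightOneSpectrum.valuedAdicCompletion_eq_valuation']
    have := Valued.v.map_add (algebraMap K (v.adicCompletion K) b - z) z
    rw [sub_add_cancel] at this
    exact this.trans (max_le hb.le z.2)
  obtain ⟨a, ha⟩ := v.exists_valuation_sub_lt_of_integer hb1 1
  refine ⟨a, sub_eq_zero.1 ?_⟩
  change IsLocalRing.residue _ (algebraMap (𝓞 K) (v.adicCompletionIntegers K) a) - _ = 0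
  rw [← map_sub, residue_eq_zero_iff_valued_lt_one]
  rw [← HeightOneSpectrum.valuedAdicCompletion_eq_valuation'] at ha
  have := Valued.v.map_add (algebraMap K (v.adicCompletion K) (algebraMap (𝓞 K) K a - b))
    (algebraMap K (v.adicCompletion K) b - z)
  rw [map_sub (algebraMap K (v.adicCompletion K)), sub_add_sub_cancel] at this
  rw [← map_sub] at this
  exact this.trans_lt (max_lt ha hb)
end Completion

/-! ### Points of the neighbourhood as integral points of the model -/

section Neighbourhoods

variable {k : Type u} [Field k] {X : Scheme.{u}} [X.Over (Spec (.of k))] {n r : ℕ}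
  {K : Type u} [Field K] [NumberField K] [Algebra k K] {C : Chart k X n r}
  {v : HeightOneSpectrum (𝓞 K)}

/-- The constants `𝓞_k → 𝓞_𝔭`. -/
def integralConstants (k : Type u) [Field k] [Algebra k K] (v : HeightOneSpectrum (𝓞 K)) :
    𝓞 k →+* v.adicCompletionIntegers K :=
  (algebraMap (𝓞 K) (v.adicCompletionIntegers K)).comp (algebraMap (𝓞 k) (𝓞 K))

lemma IsPoint.apply_modelConstants {t : Γ(X, C.U) →+* v.adicCompletion K} (ht : IsPoint C v t)
    (a : 𝓞 k) : t (C.modelConstants a) = integralConstants k v a := by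
  rw [C.coe_modelConstants]
  exact congr($ht (algebraMap (𝓞 k) k a))

/-- Integrality and congruence pass from the coordinates to the ring they generate over `𝓞 k`. -/
lemma mem_integers_of_mem_neighbourhood {y t : Γ(X, C.U) →+* v.adicCompletion K}
    (hy : IsPoint C v y) (hyi : ∀ i, Valued.v (y (C.coord i)) ≤ 1)
    (ht : t ∈ neighbourhood C v y) (a : C.model) :
    t a ∈ v.adicCompletionIntegers K ∧ Valued.v (t a - y a) < 1 := by
  suffices h : y a ∈ v.adicCompletionIntegers K ∧ Valued.v (t a - y a) < 1 by
    refine ⟨?_, h.2⟩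
    rw [← sub_add_cancel (t a) (y a)]
    exact add_mem (show t a - y a ∈ v.adicCompletionIntegers K from h.2.le) h.1
  refine C.model_induction_on
    (p := fun a ↦ y a ∈ v.adicCompletionIntegers K ∧ Valued.v (t a - y a) < 1) a
    (fun a ↦ ?_) (fun i ↦ ⟨hyi i, ht.2 i⟩) (fun a b ha hb ↦ ?_) (fun a b ha hb ↦ ?_)
  · rw [← C.coe_modelConstants, ht.1.apply_modelConstants, hy.apply_modelConstants, sub_self,
      map_zero]
    exact ⟨SetLike.coe_mem _, zero_lt_one⟩
  · rw [map_add, map_add, add_sub_add_comm]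
    exact ⟨add_mem ha.1 hb.1, (Valued.v.map_add _ _).trans_lt (max_lt ha.2 hb.2)⟩
  · rw [map_mul, map_mul]
    refine ⟨mul_mem ha.1 hb.1, ?_⟩
    have e : t a * t b - y a * y b = (t a - y a) * ((t b - y b) + y b) + y a * (t b - y b) := by
      ring
    have hb' : Valued.v (t b - y b + y b) ≤ 1 :=
      (Valued.v.map_add _ _).trans (max_le hb.2.le hb.1)
    rw [e]
    refine (Valued.v.map_add _ _).trans_lt (max_lt ?_ ?_)
    · rw [map_mul]
      exact (mul_le_of_le_one_right' hb').trans_lt ha.2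
    · rw [map_mul]
      exact (mul_le_of_le_one_left' ha.1).trans_lt hb.2

lemma exists_integral_point {y t : Γ(X, C.U) →+* v.adicCompletion K}
    {x : C.model →+* IsLocalRing.ResidueField (v.adicCompletionIntegers K)}
    (hy : IsPoint C v y) (hyi : ∀ i, Valued.v (y (C.coord i)) ≤ 1) (hx : IsReduction C v y x)
    (ht : t ∈ neighbourhood C v y) :
    ∃ h : C.model →+* v.adicCompletionIntegers K, (∀ a, (h a : v.adicCompletion K) = t a) ∧
      (IsLocalRing.residue _).comp h = x ∧ h.comp C.modelConstants = integralConstants k v := by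
  have key := mem_integers_of_mem_neighbourhood hy hyi ht
  refine ⟨(t.comp C.model.subtype).codRestrict (v.adicCompletionIntegers K) fun a ↦ (key a).1,
    fun a ↦ rfl, RingHom.ext fun a ↦ ?_, RingHom.ext fun a ↦ ?_⟩
  · obtain ⟨h1, h2⟩ := hx a
    rw [h2, RingHom.comp_apply, ← sub_eq_zero, ← map_sub, residue_eq_zero_iff_valued_lt_one]
    exact (key a).2
  · exact Subtype.ext (ht.1.apply_modelConstants a)

end Neighbourhoods

end PadicDynamics

end

/-! ### From orbits of integral points to orbits in `X` -/

theorem mainTheorem3 {k : Type u} [Field k] [NumberField k]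
    {X : Scheme.{u}} [X.Over (Spec (.of k))] [IsIntegral X]
    [IsSeparated (X ↘ Spec (.of k))] [LocallyOfFiniteType (X ↘ Spec (.of k))]
    [QuasiCompact (X ↘ Spec (.of k))]
    (f : X.RationalMap X) [f.IsOver (Spec (.of k))] [f.IsDominant]
    {n r : ℕ} (C : PadicDynamics.Chart k X n r)
    {K : Type u} [Field K] [NumberField K] [Algebra k K]
    (v' : HeightOneSpectrum (𝓞 k)) (v : HeightOneSpectrum (𝓞 K))
    (y : Γ(X, C.U) →+* v.adicCompletion K)
    (hy : PadicDynamics.NeighbourhoodData f C v' v y) :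
    ∃ N : ℕ, 0 < N ∧ ∀ t ∈ PadicDynamics.neighbourhood C v y,
      PadicDynamics.IsPreperiodic f (C.toPoint t) →
        PadicDynamics.IsPeriodicOfPeriodLE f N (C.toPoint t) := by
  open PadicDynamics in
  have : X.IsSeparated := isSeparated_of_over_affine (S := Spec (.of k))
  obtain ⟨g, hg, x, m, hx0, hm, hxm, hstep⟩ := hy.periodic
  have hconst := C.pullback_comp_constants hg
  choose φ hφg hφx hφu using hstep
  have hφc (i : ℕ) (hi : i < m) : (φ i hi).comp C.modelConstants =
      (algebraMap C.model _).comp C.modelConstants := RingHom.ext fun a ↦ by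
    apply toField_injective C.modelToField_injective (x i)
    rw [RingHom.comp_apply, RingHom.comp_apply, hφg, toField_algebraMap]
    change g _ = (X.germToFunctionField C.U).hom _
    refine (congr(g $(C.coe_modelConstants a))).trans (Eq.trans ?_
      congr((X.germToFunctionField C.U).hom $((C.coe_modelConstants a).symm)))
    exact congr($hconst (algebraMap (𝓞 k) k a))
  -- Every `x i` lies in the closed fibre: `x 0` does because `𝔭` lies over `𝔭'`, and `f` preserves
  -- constants.
  have hxp (i : ℕ) (hi : i ≤ m) (a : 𝓞 k) (ha : a ∈ v'.asIdeal) :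
      x i (C.modelConstants a) = 0 := by
    induction i with
    | zero =>
      obtain ⟨h1, h2⟩ := hx0 (C.modelConstants a)
      have e : (⟨_, h1⟩ : v.adicCompletionIntegers K) = integralConstants k v a :=
        Subtype.ext (hy.isPoint.apply_modelConstants a)
      rw [h2, e]
      rw [← hy.liesOver] at ha
      exact residue_algebraMap_eq_zero v ha
    | succ i ih =>
      rw [← hφx i hi]
      have := congr(evalAt (x i) ($(hφc i hi) a))
      rw [RingHom.comp_apply] at this
      rw [this, ← ih (by omega)]
      exact congr($(evalAt_comp_algebraMap (x i)) (C.modelConstants a))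
  -- Indices modulo `m` unroll the cycle; the wrap-around in `hxσ` is `x m = x 0`.
  let σ : ℕ → Fin m := fun i ↦ ⟨i % m, Nat.mod_lt i hm⟩
  have hσ : Function.Periodic σ m := fun i ↦ Fin.ext (Nat.add_mod_right i m)
  have hxσ (i : ℕ) : x (σ (i + 1)) = x (i % m + 1) := by
    change x ((i + 1) % m) = _
    rw [← Nat.mod_add_mod]
    obtain h | h := (Nat.succ_le_of_lt (Nat.mod_lt i hm)).eq_or_lt
    · rw [← Nat.succ_eq_add_one, h, Nat.mod_self, hxm]
    · rw [Nat.mod_eq_of_lt h]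
  obtain ⟨N, hN0, hN⟩ := IsOrbit.exists_period_bound (x := fun j : Fin m ↦ x j) (σ := σ)
    (φ := fun j ↦ φ j j.2) (IsLocalRing.residue (v.adicCompletionIntegers K)) hσ hm
    (fun i ↦ by rw [hxσ]; exact RingHom.ext (hφx (i % m) _))
    (fun j ↦ formallyUnramified_of_reduction C.modelConstants_finiteType (hφc j j.2)
      v'.asIdeal (hxp j j.2.le) (hφu j j.2))
    C.modelConstants_finiteType (fun j ↦ hφc j j.2) (integralConstants k v)
  refine ⟨N, hN0, fun t ht ⟨i, j, hij, b, hi, hj⟩ ↦ ⟨N, hN0, le_rfl, ?_⟩⟩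
  obtain ⟨h, hht, hhx, hhc⟩ := exists_integral_point hy.isPoint hy.coord_integral hx0 ht
  have hσ0 : x (σ 0) = x 0 := by simp [σ]
  obtain ⟨w, hw0, hw⟩ := IsOrbit.exists_orbit (x := fun j : Fin m ↦ x j) (σ := σ)
    (φ := fun j ↦ φ j j.2) (IsLocalRing.residue (v.adicCompletionIntegers K))
    (fun i ↦ by rw [hxσ]; exact RingHom.ext (hφx (i % m) _)) h (by rw [hhx, hσ0])
  have hnext (i : ℕ) (s : {s : Γ(X, C.U) →+* v.adicCompletion K // ∀ a : C.model, s a = w i a}) :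
      ∃ s' : {s : Γ(X, C.U) →+* v.adicCompletion K // ∀ a : C.model, s a = w (i + 1) a},
        MapsTo f (C.toPoint s.1) (C.toPoint s'.1) := by
    obtain ⟨l, h1, h2⟩ := hw i
    obtain ⟨s', h3, h4⟩ := C.exists_mapsTo_of_local hg (hφg (σ i) (σ i).2) s.1
      ((v.adicCompletionIntegers K).subtype.comp l) fun a ↦ by
        rw [s.2, ← h1]
        rfl
    refine ⟨⟨s', fun a ↦ ?_⟩, h3⟩
    rw [h4, ← h2]
    rfl
  choose F hF using hnext
  -- The `f`-orbit of `t` stays in `U`, and its restriction to the model is the integral orbit `w`.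
  let τ : ∀ i, {s : Γ(X, C.U) →+* v.adicCompletion K // ∀ a : C.model, s a = w i a} :=
    fun i ↦ Nat.rec ⟨t, fun a ↦ by rw [hw0, hht]⟩ F i
  have hτ (i : ℕ) : MapsTo f (C.toPoint (τ i).1) (C.toPoint (τ (i + 1)).1) := hF i (τ i)
  have hτi (i : ℕ) : IterMapsTo f i (C.toPoint t) (C.toPoint (τ i).1) := by
    induction i with
    | zero => rfl
    | succ i ih => exact ⟨_, ih, hτ i⟩
  -- Uniqueness of values turns `f^i(t) = f^j(t)` in `X` into equality of all later points of the
  -- orbit.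
  have hτs (s : ℕ) : (τ (i + s)).1 = (τ (j + s)).1 := by
    induction s with
    | zero => exact C.toPoint_injective (((hτi i).unique hi).trans ((hτi j).unique hj).symm)
    | succ s ih =>
      have := hτ (i + s)
      rw [ih] at this
      exact C.toPoint_injective (this.unique (hτ (j + s)))
  have hwN := hN w hw (by rw [hw0, hhx, hσ0]) (by rw [hw0, hhc]) ⟨i, j, hij, fun s ↦
    RingHom.ext fun a ↦ Subtype.ext (by rw [← (τ (i + s)).2, ← (τ (j + s)).2, hτs])⟩
  have hτN : (τ N).1 = t := C.ringHom_ext_of_model fun a ↦ by rw [(τ N).2, hwN, hw0, hht]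
  have := hτi N
  rwa [hτN] at this
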